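/- Let $d\ge 2$ and let $(\tau_e)$ be a family of independent, identically distributed non-negative real random variables, indexed by the nearest-neighbour edges $e$ of $\mathbb Z^d$. A finite path from $x$ to $y$ ($x,y\in\mathbb Z^d$) is a sequence of vertices $x=x_0,x_1,\dots,x_k=y$ of $\mathbb Z^d$ in which $x_{i-1}$ and $x_i$ are nearest neighbours for every $i$; its passage time is $\sum_{i=1}^k\tau_{\{x_{i-1},x_i\}}$, and $T(x,y)$ denotes the infimum of the passage times of all finite paths from $x$ to $y$. Let $t_1,\dots,t_{2d}$ be i.i.d. copies of $\tau_e$ and assume that $$\mathbb E\min[t_1,\dots,t_{2d}]<\infty .$$ Then, with $e_1=(1,0,\dots,0)$, the variables $T(0,ne_1)$ are integrable and there exists a constant $\mu(e_1)\in[0,\infty)$ such that $$\lim_{n\to\infty}\frac{T(0,ne_1)}{n}=\mu(e_1)\qquad\text{almost surely and in }L^1 .$$ -/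

import Mathlib

open MeasureTheory ProbabilityTheory Filter Topology

namespace FPP

/-- The nearest-neighbour graph on `ℤ^d`: two points are joined iff their `ℓ¹` distance is `1`. -/
def latticeGraph (d : ℕ) : SimpleGraph (Fin d → ℤ) where
  Adj x y := ∑ i, |x i - y i| = 1
  symm := ⟨fun x y h => by simpa only [abs_sub_comm] using h⟩
  loopless := ⟨fun x h => by simp at h⟩

/-- The set of nearest-neighbour edges of `ℤ^d`, as a type. -/
abbrev Edge (d : ℕ) : Type := (latticeGraph d).edgeSet

/-- The passage time `T(Γ)` of a finite lattice path `Γ`: the sum of the weights of its edges. -/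
def pathTime {d : ℕ} (w : Edge d → ℝ) {x y : Fin d → ℤ} (p : (latticeGraph d).Walk x y) : ℝ :=
  (p.darts.map fun a => w ⟨a.edge, a.edge_mem⟩).sum

/-- The passage time `T(x, y)`: the infimum of `T(Γ)` over all finite lattice paths `Γ` from `x`
to `y`. There is always at least one such path, and for non-negative weights the infimum is over
a set bounded below by `0`. -/
noncomputable def passageTime {d : ℕ} (w : Edge d → ℝ) (x y : Fin d → ℤ) : ℝ :=
  ⨅ p : (latticeGraph d).Walk x y, pathTime w p

/-- The first coordinate vector `e₁` of `ℤ^d`. -/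
def e₁ (d : ℕ) : Fin d → ℤ := fun i => if (i : ℕ) = 0 then 1 else 0

end FPP

/-! Translating the weights by one unit along the first axis turns `T(0, n e₁)` into a non-negative
subadditive cocycle, because paths can be concatenated. The limit is then Kingman's subadditive
ergodic theorem, `IsSubadditiveCocycle.tendsto_ae`, and it is constant because the shift is ergodic.

The ergodic theorem rests on greedy coverings of an orbit: stretches with a good average are
traversed whole, rare bad points are passed singly, and a final stretch of bounded length costs
nothing after division by the total length. Ergodicity (`ergodic_edgeShift`) holds because a
translation carries any finite set of edges off itself, which makes cylinder events asymptotically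
independent.

The moment hypothesis enters only through `integrable_axisTime_one`: `0` and `e₁` are joined by `2d`
edge-disjoint paths of length at most 9, so `T(0, e₁)` is controlled by minima over `2d` distinct
edges. Since the means `E T(0, n e₁) / n` have the same limit, Scheffé's lemma upgrades almost sure
convergence to `L¹`. -/

namespace FPP

/-! ### Covering inequalities along an orbit -/

section Cocycle

variable {Ω : Type*} {θ : Ω → Ω}

theorem birkhoffSum_nonneg {f : Ω → ℝ} (hf : ∀ ω, 0 ≤ f ω) (n : ℕ) (ω : Ω) :
    0 ≤ birkhoffSum θ f n ω :=
  Finset.sum_nonneg fun _ _ => hf _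

theorem birkhoffSum_mono_right {f : Ω → ℝ} (hf : ∀ ω, 0 ≤ f ω) {m n : ℕ} (h : m ≤ n) (ω : Ω) :
    birkhoffSum θ f m ω ≤ birkhoffSum θ f n ω :=
  Finset.sum_le_sum_of_subset_of_nonneg (by simpa using h) fun _ _ _ => hf _

/-- Greedy walk along the orbit: off `B`, jump ahead by a time whose average is at least `a`; on
`B`, advance one step and let the indicator pay `a`. Once at most `N` steps remain, `a * N` pays for
them. -/
theorem le_birkhoffSum_add_of_cover {f : Ω → ℝ} (hf : ∀ ω, 0 ≤ f ω) {a : ℝ} (ha : 0 ≤ a) (N : ℕ)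
    {B : Set Ω} (hB : ∀ ω ∉ B, ∃ n, 1 ≤ n ∧ n ≤ N ∧ a * n ≤ birkhoffSum θ f n ω) (M : ℕ) (ω : Ω) :
    a * M ≤ birkhoffSum θ f M ω + birkhoffSum θ (B.indicator fun _ => a) M ω + a * N := by
  have hind : ∀ ω, 0 ≤ B.indicator (fun _ => a) ω := Set.indicator_nonneg fun _ _ => ha
  induction M using Nat.strong_induction_on generalizing ω with
  | _ M ih =>
    rcases le_or_gt M N with hMN | hMN
    · have : (M : ℝ) ≤ N := by exact_mod_cast hMN
      nlinarith [birkhoffSum_nonneg (θ := θ) hf M ω, birkhoffSum_nonneg (θ := θ) hind M ω]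
    · by_cases hω : ω ∈ B
      · obtain ⟨m, rfl⟩ : ∃ m, M = 1 + m := ⟨M - 1, by omega⟩
        have h := ih m (by omega) (θ ω)
        rw [birkhoffSum_add, birkhoffSum_add]
        simp only [birkhoffSum_one, Function.iterate_one, Set.indicator_of_mem hω]
        push_cast
        linarith [hf ω]
      · obtain ⟨n, hn1, hnN, hn⟩ := hB ω hω
        obtain ⟨m, rfl⟩ : ∃ m, M = n + m := ⟨M - n, by omega⟩
        have h := ih m (by omega) (θ^[n] ω)
        rw [birkhoffSum_add, birkhoffSum_add]
        push_cast
        linarith [birkhoffSum_nonneg (θ := θ) hind n ω]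

/-- A non-negative subadditive cocycle over `θ`. -/
structure IsSubadditiveCocycle (θ : Ω → Ω) (g : ℕ → Ω → ℝ) : Prop where
  nonneg : ∀ n ω, 0 ≤ g n ω
  zero : ∀ ω, g 0 ω = 0
  add_le : ∀ m n ω, g (m + n) ω ≤ g m ω + g n (θ^[m] ω)

namespace IsSubadditiveCocycle

variable {g : ℕ → Ω → ℝ}

theorem le_birkhoffSum (hg : IsSubadditiveCocycle θ g) (k n : ℕ) (ω : Ω) :
    g (k * n) ω ≤ birkhoffSum θ^[k] (g k) n ω := by
  induction n with
  | zero => simp [hg.zero]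
  | succ n ih =>
    rw [birkhoffSum_succ, mul_add_one, ← Function.iterate_mul]
    linarith [hg.add_le (k * n) k ω]

theorem le_birkhoffSum_one (hg : IsSubadditiveCocycle θ g) (n : ℕ) (ω : Ω) :
    g n ω ≤ birkhoffSum θ (g 1) n ω := by
  simpa using hg.le_birkhoffSum 1 n ω

/-- The same greedy walk, with subadditivity gluing the pieces. Steps from `B` are paid by `g 1`,
and the unfinished end by the sum of `g 1` over the last `N` positions; truncated subtraction starts
this window at `0` when `M ≤ N`. -/
theorem le_birkhoffSum_of_cover (hg : IsSubadditiveCocycle θ g) {b : ℝ} (hb : 0 ≤ b) (N : ℕ)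
    {B : Set Ω} (hB : ∀ ω ∉ B, ∃ n, 1 ≤ n ∧ n ≤ N ∧ g n ω ≤ b * n) (M : ℕ) (ω : Ω) :
    g M ω ≤ b * M + birkhoffSum θ (B.indicator (g 1)) M ω +
      birkhoffSum θ (g 1) N (θ^[M - N] ω) := by
  have hind : ∀ ω, 0 ≤ B.indicator (g 1) ω := Set.indicator_nonneg fun _ _ => hg.nonneg 1 _
  induction M using Nat.strong_induction_on generalizing ω with
  | _ M ih =>
    rcases le_or_gt M N with hMN | hMN
    · have h0 : 0 ≤ b * M := by positivity
      rw [Nat.sub_eq_zero_of_le hMN, Function.iterate_zero_apply]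
      linarith [birkhoffSum_nonneg (θ := θ) hind M ω, hg.le_birkhoffSum_one M ω,
        birkhoffSum_mono_right (θ := θ) (hg.nonneg 1) hMN ω]
    · by_cases hω : ω ∈ B
      · obtain ⟨m, rfl⟩ : ∃ m, M = 1 + m := ⟨M - 1, by omega⟩
        have h := ih m (by omega) (θ ω)
        rw [birkhoffSum_add]
        simp only [birkhoffSum_one, Function.iterate_one, Set.indicator_of_mem hω]
        rw [show 1 + m - N = (m - N) + 1 by omega, Function.iterate_succ_apply]
        have := hg.add_le 1 m ω
        rw [Function.iterate_one] at this
        push_cast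
        linarith
      · obtain ⟨n, hn1, hnN, hn⟩ := hB ω hω
        obtain ⟨m, rfl⟩ : ∃ m, M = n + m := ⟨M - n, by omega⟩
        have h := ih m (by omega) (θ^[n] ω)
        rw [birkhoffSum_add]
        -- If `N ≤ m`, both final windows coincide. Otherwise the jump lands inside the final
        -- window, and the remaining `m` steps are its last `m` positions.
        have h2 : birkhoffSum θ (g 1) N (θ^[m - N] (θ^[n] ω)) ≤
            birkhoffSum θ (g 1) N (θ^[n + m - N] ω) ∨ m < N := by
          rcases le_or_gt N m with h | h
          · left
            rw [← Function.iterate_add_apply, show m - N + n = n + m - N by omega]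
          · exact .inr h
        push_cast
        rcases h2 with h2 | h2
        · linarith [birkhoffSum_nonneg (θ := θ) hind n ω, hg.add_le n m ω]
        · have h3 : g m (θ^[n] ω) ≤ birkhoffSum θ (g 1) N (θ^[n + m - N] ω) := by
            refine (hg.le_birkhoffSum_one m _).trans ?_
            obtain ⟨j, rfl⟩ : ∃ j, N = j + m := ⟨N - m, by omega⟩
            rw [birkhoffSum_add, ← Function.iterate_add_apply,
              show j + (n + m - (j + m)) = n by omega]
            linarith [birkhoffSum_nonneg (θ := θ) (hg.nonneg 1) j (θ^[n + m - (j + m)] ω)]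
          have h4 : 0 ≤ b * m := by positivity
          linarith [birkhoffSum_nonneg (θ := θ) hind n ω, hg.add_le n m ω,
            birkhoffSum_nonneg (θ := θ) hind m (θ^[n] ω)]

end IsSubadditiveCocycle

end Cocycle

/-! ### The subadditive ergodic theorem and convergence in mean -/

section Ergodic

variable {Ω : Type*} [MeasurableSpace Ω] {P : Measure Ω} {θ : Ω → Ω}

theorem integrable_birkhoffSum (hθ : MeasurePreserving θ P P) {f : Ω → ℝ} (hf : Integrable f P)
    (n : ℕ) : Integrable (birkhoffSum θ f n) P :=
  integrable_finsetSum _ fun k _ => (hθ.iterate k).integrable_comp_of_integrable hf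

theorem integral_comp_of_measurePreserving {Ω' : Type*} [MeasurableSpace Ω'] {Q : Measure Ω'}
    {φ : Ω → Ω'} (hφ : MeasurePreserving φ P Q) {f : Ω' → ℝ} (hf : Measurable f) :
    ∫ ω, f (φ ω) ∂P = ∫ x, f x ∂Q := by
  rw [← hφ.map_eq, integral_map hφ.measurable.aemeasurable hf.aestronglyMeasurable]

theorem integral_birkhoffSum (hθ : MeasurePreserving θ P P) {f : Ω → ℝ} (hfm : Measurable f)
    (hf : Integrable f P) (n : ℕ) : ∫ ω, birkhoffSum θ f n ω ∂P = n * ∫ ω, f ω ∂P := by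
  simp only [birkhoffSum]
  rw [integral_finsetSum (f := fun k ω => f (θ^[k] ω)) _
    fun k _ => (hθ.iterate k).integrable_comp_of_integrable hf]
  simp [integral_comp_of_measurePreserving (hθ.iterate _) hfm]

theorem measurable_birkhoffSum (hθ : Measurable θ) {f : Ω → ℝ} (hf : Measurable f) (n : ℕ) :
    Measurable (birkhoffSum θ f n) :=
  Finset.measurable_sum _ fun k _ => hf.comp (hθ.iterate k)

/-- If almost every point lies in one of the increasing sets complementary to `B N`, then the
integrals over `B N` become small. -/
theorem exists_integral_indicator_lt {f : Ω → ℝ} (hf : Integrable f P) {B : ℕ → Set Ω}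
    (hB : ∀ N, MeasurableSet (B N)) (hanti : Antitone B) (hnull : ∀ᵐ ω ∂P, ∃ N, ω ∉ B N)
    {ε : ℝ} (hε : 0 < ε) : ∃ N, ∫ ω, (B N).indicator f ω ∂P < ε := by
  have h := tendsto_setIntegral_of_antitone hB hanti ⟨0, hf.integrableOn⟩
  have h0 : P (⋂ N, B N) = 0 := by
    rw [ae_iff] at hnull
    convert hnull using 2
    ext ω
    simp
  rw [setIntegral_measure_zero f h0] at h
  obtain ⟨N, hN⟩ := (h.eventually (gt_mem_nhds hε)).exists
  exact ⟨N, by rwa [integral_indicator (hB N)]⟩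

/-- Letting `M` tend to infinity in an inequality that is affine in `M`. -/
theorem le_of_forall_mul_le_add {x y z : ℝ} (h : ∀ M : ℕ, M * x ≤ M * y + z) : x ≤ y := by
  by_contra! hlt
  obtain ⟨M, hM⟩ := exists_nat_gt (z / (x - y))
  rw [div_lt_iff₀ (sub_pos.2 hlt)] at hM
  nlinarith [h M]

/-- A measurable set which is mapped into itself by an ergodic map, up to a null set, is null or
conull. -/
theorem ae_or_ae_not_of_imp [IsProbabilityMeasure P] (hθ : Ergodic θ P) {p : Ω → Prop}
    (hp : MeasurableSet {ω | p ω}) (himp : ∀ ω, p ω → p (θ ω)) :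
    (∀ᵐ ω ∂P, p ω) ∨ ∀ᵐ ω ∂P, ¬ p ω := by
  rcases hθ.ae_empty_or_univ_of_ae_le_preimage (s := {ω | p ω}) hp.nullMeasurableSet
    (Eventually.of_forall himp) with h | h
  · right
    filter_upwards [eventuallyEq_set.1 h] with ω hω hpω
    exact hω.1 hpω
  · left
    filter_upwards [eventuallyEq_set.1 h] with ω hω
    exact hω.2 trivial

theorem frequently_comparison_absorb {C a b : ℝ} (hab : a < b) {u : ℕ → ℝ}
    (h : ∃ᶠ n : ℕ in atTop, b * n ≤ u n + C) : ∃ n : ℕ, 1 ≤ n ∧ a * n ≤ u n := by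
  obtain ⟨N, hN⟩ := exists_nat_gt (C / (b - a))
  rw [div_lt_iff₀ (sub_pos.2 hab)] at hN
  obtain ⟨n, hn, h⟩ := h.forall_exists_of_atTop (max N 1)
  refine ⟨n, (le_max_right _ _).trans hn, ?_⟩
  have : (N : ℝ) ≤ n := by exact_mod_cast (le_max_left _ _).trans hn
  nlinarith

/-- The upper half of Birkhoff's ergodic theorem for non-negative functions. -/
theorem eventually_birkhoffSum_le [IsProbabilityMeasure P] (hθ : Ergodic θ P) {f : Ω → ℝ}
    (hfm : Measurable f) (hfi : Integrable f P) (hf : ∀ ω, 0 ≤ f ω) {b : ℝ}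
    (hb : ∫ ω, f ω ∂P < b) : ∀ᵐ ω ∂P, ∀ᶠ n : ℕ in atTop, birkhoffSum θ f n ω ≤ b * n := by
  have hmp := hθ.toMeasurePreserving
  have hSm := measurable_birkhoffSum hθ.measurable hfm
  -- Allowing an arbitrary constant `C` makes the event forward invariant: dropping the first step
  -- changes both sides by amounts independent of `n`.
  let p : Ω → Prop := fun ω => ∃ C : ℕ, ∃ᶠ n : ℕ in atTop, b * n ≤ birkhoffSum θ f n ω + C
  have hp : MeasurableSet {ω | p ω} := by
    simp only [p, frequently_atTop, Set.ofPred_exists, Set.ofPred_forall]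
    refine .iUnion fun C => .iInter fun N => .iUnion fun n => ?_
    simp only [Set.ofPred_and]
    exact (MeasurableSet.const _).inter (measurableSet_le measurable_const ((hSm n).add_const _))
  have himp : ∀ ω, p ω → p (θ ω) := by
    rintro ω ⟨C, hC⟩
    obtain ⟨D, hD⟩ := exists_nat_ge (f ω + |b|)
    refine ⟨C + D, ?_⟩
    rw [frequently_atTop] at hC ⊢
    intro N
    obtain ⟨n, hn, h⟩ := hC (N + 1)
    obtain ⟨m, rfl⟩ : ∃ m, n = 1 + m := ⟨n - 1, by omega⟩
    refine ⟨m, by omega, ?_⟩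
    rw [birkhoffSum_add] at h
    simp only [birkhoffSum_one, Function.iterate_one] at h
    push_cast at h ⊢
    linarith [neg_abs_le b]
  rcases ae_or_ae_not_of_imp hθ hp himp with h | h
  -- With `a` strictly between the mean and `b`, almost every point has a time of average at least
  -- `a`. Integrating the covering inequality and dividing by `M` gives `a ≤ ∫ f + ∫_B a`, which is
  -- less than `a` for large `N`.
  · exfalso
    obtain ⟨a, ha, hab⟩ := exists_between hb
    have ha0 : 0 ≤ a := (integral_nonneg hf).trans ha.le
    let B : ℕ → Set Ω := fun N => {ω | ∀ n, 1 ≤ n → n ≤ N → birkhoffSum θ f n ω < a * n}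
    have hBm : ∀ N, MeasurableSet (B N) := fun N => by
      simp only [B, Set.ofPred_forall]
      exact .iInter fun n => .iInter fun _ => .iInter fun _ =>
        measurableSet_lt (hSm n) measurable_const
    have hanti : Antitone B := fun N N' h ω hω n h1 h2 => hω n h1 (h2.trans h)
    obtain ⟨N, hN⟩ := exists_integral_indicator_lt (P := P) (integrable_const a) hBm hanti
      (by
        filter_upwards [h] with ω ⟨C, hC⟩
        obtain ⟨n, h1, hn⟩ := frequently_comparison_absorb hab hC
        exact ⟨n, fun hB => absurd hn (not_le.2 (hB n h1 le_rfl))⟩) (sub_pos.2 ha)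
    have hind : Integrable ((B N).indicator fun _ => a) P := (integrable_const a).indicator (hBm N)
    have hindm : Measurable ((B N).indicator fun _ => a) := measurable_const.indicator (hBm N)
    have key : a ≤ ∫ ω, f ω ∂P + ∫ ω, (B N).indicator (fun _ => a) ω ∂P := by
      refine le_of_forall_mul_le_add (z := a * N) fun M => ?_
      have hle := integral_mono (μ := P) (integrable_const (a * M))
        (((integrable_birkhoffSum hmp hfi M).add (integrable_birkhoffSum hmp hind M)).add
          (integrable_const (a * N)))
        (le_birkhoffSum_add_of_cover (θ := θ) hf ha0 N (B := B N) (fun ω hω => by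
          simpa [B] using hω) M)
      rw [integral_add' ((integrable_birkhoffSum hmp hfi M).add
        (integrable_birkhoffSum hmp hind M)) (integrable_const _),
        integral_add' (integrable_birkhoffSum hmp hfi M) (integrable_birkhoffSum hmp hind M),
        integral_birkhoffSum hmp hfm hfi, integral_birkhoffSum hmp hindm hind] at hle
      simp only [integral_const, probReal_univ, one_smul] at hle
      linarith
    linarith
  · filter_upwards [h] with ω hω
    by_contra hc
    refine hω ⟨0, (not_eventually.1 hc).mono fun n hn => ?_⟩
    push Not at hn
    simpa using hn.le

namespace IsSubadditiveCocycle

variable {g : ℕ → Ω → ℝ}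

theorem integrable (hg : IsSubadditiveCocycle θ g) (hθ : MeasurePreserving θ P P)
    (hm : ∀ n, Measurable (g n)) (hi : Integrable (g 1) P) (n : ℕ) : Integrable (g n) P :=
  (integrable_birkhoffSum hθ hi n).mono' (hm n).aestronglyMeasurable <| .of_forall fun ω => by
    rw [Real.norm_of_nonneg (hg.nonneg n ω)]
    exact hg.le_birkhoffSum_one n ω

theorem subadditive_integral (hg : IsSubadditiveCocycle θ g) (hθ : MeasurePreserving θ P P)
    (hm : ∀ n, Measurable (g n)) (hi : ∀ n, Integrable (g n) P) :
    Subadditive fun n => ∫ ω, g n ω ∂P := fun m n => by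
  have hi' := (hθ.iterate m).integrable_comp_of_integrable (hi n)
  refine (integral_mono (hi _) ((hi m).add hi') (hg.add_le m n)).trans ?_
  rw [integral_add' (hi m) hi']
  exact (congrArg _ (integral_comp_of_measurePreserving (hθ.iterate m) (hm n))).le

variable [IsProbabilityMeasure P]

/-- The lower half of the subadditive ergodic theorem. -/
theorem eventually_le (hg : IsSubadditiveCocycle θ g) (hθ : Ergodic θ P)
    (hm : ∀ n, Measurable (g n)) (hi : ∀ n, Integrable (g n) P) {L a : ℝ}
    (hL : ∀ n : ℕ, n * L ≤ ∫ ω, g n ω ∂P) (ha : a < L) :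
    ∀ᵐ ω ∂P, ∀ᶠ n : ℕ in atTop, a * n ≤ g n ω := by
  have hmp := hθ.toMeasurePreserving
  rcases lt_or_ge a 0 with ha0 | ha0
  · exact .of_forall fun ω => .of_forall fun n =>
      (mul_nonpos_of_nonpos_of_nonneg ha0.le n.cast_nonneg).trans (hg.nonneg n ω)
  -- The universally quantified `C` absorbs the cost `g 1 ω` of the first step, so `p` is forward
  -- invariant. Where `p` fails, `g n ≤ a n + C` infinitely often, hence `g n ≤ b n` for some `n ≥
  -- 1` and any `b > a`.
  let p : Ω → Prop := fun ω => ∀ C : ℕ, ∀ᶠ n : ℕ in atTop, a * n + C < g n ω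
  have hp : MeasurableSet {ω | p ω} := by
    simp only [p, eventually_atTop, Set.ofPred_exists, Set.ofPred_forall]
    exact .iInter fun C => .iUnion fun N => .iInter fun n => .iInter fun _ =>
      measurableSet_lt measurable_const (hm n)
  have himp : ∀ ω, p ω → p (θ ω) := by
    intro ω hω C
    obtain ⟨D, hD⟩ := exists_nat_ge (g 1 ω)
    obtain ⟨N, hN⟩ := eventually_atTop.1 (hω (C + D))
    refine eventually_atTop.2 ⟨N, fun n hn => ?_⟩
    have h := hN (1 + n) (by omega)
    have h' := hg.add_le 1 n ω
    rw [Function.iterate_one] at h'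
    push_cast at h
    linarith
  rcases ae_or_ae_not_of_imp hθ hp himp with h | h
  · filter_upwards [h] with ω hω
    simpa using (hω 0).mono fun n hn => hn.le
  · exfalso
    obtain ⟨b, hab, hbL⟩ := exists_between ha
    have hb0 : 0 ≤ b := ha0.trans hab.le
    let B : ℕ → Set Ω := fun N => {ω | ∀ n, 1 ≤ n → n ≤ N → b * n < g n ω}
    have hBm : ∀ N, MeasurableSet (B N) := fun N => by
      simp only [B, Set.ofPred_forall]
      exact .iInter fun n => .iInter fun _ => .iInter fun _ =>
        measurableSet_lt measurable_const (hm n)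
    have hanti : Antitone B := fun N N' h ω hω n h1 h2 => hω n h1 (h2.trans h)
    obtain ⟨N, hN⟩ := exists_integral_indicator_lt (P := P) (hi 1) hBm hanti
      (by
        filter_upwards [h] with ω hω
        simp only [p, not_forall, not_eventually, not_lt] at hω
        obtain ⟨C, hC⟩ := hω
        obtain ⟨n, h1, hn⟩ := frequently_comparison_absorb (a := -b) (b := -a) (C := C)
          (u := fun n => - g n ω) (by linarith) (hC.mono fun n hn => by linarith)
        exact ⟨n, fun hB => absurd (hB n h1 le_rfl) (by linarith)⟩) (sub_pos.2 hbL)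
    have hind : Integrable ((B N).indicator (g 1)) P := (hi 1).indicator (hBm N)
    have hindm : Measurable ((B N).indicator (g 1)) := (hm 1).indicator (hBm N)
    have key : L ≤ b + ∫ ω, (B N).indicator (g 1) ω ∂P := by
      refine le_of_forall_mul_le_add (z := N * ∫ ω, g 1 ω ∂P) fun M => ?_
      have i1 := integrable_birkhoffSum hmp hind M
      have i2 := (hmp.iterate (M - N)).integrable_comp_of_integrable
        (integrable_birkhoffSum hmp (hi 1) N)
      have hle := integral_mono (μ := P) (hi M) (((integrable_const (b * M)).add i1).add i2)
        (hg.le_birkhoffSum_of_cover hb0 N (B := B N) (fun ω hω => by simpa [B] using hω) M)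
      rw [integral_add' ((integrable_const (b * M)).add i1) i2,
        integral_add' (integrable_const (b * M)) i1, integral_birkhoffSum hmp hindm hind] at hle
      have e := integral_comp_of_measurePreserving (hmp.iterate (M - N))
        (measurable_birkhoffSum hθ.measurable (hm 1) N)
      rw [integral_birkhoffSum hmp (hm 1) (hi 1)] at e
      simp only [Function.comp_apply, integral_const, probReal_univ, one_smul] at hle
      linarith [hL M]
    linarith

/-- The upper half of the subadditive ergodic theorem. -/
theorem eventually_ge (hg : IsSubadditiveCocycle θ g) (hθ : ∀ k, 0 < k → Ergodic θ^[k] P)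
    (hm : ∀ n, Measurable (g n)) (hi : ∀ n, Integrable (g n) P) {k : ℕ} (hk : 0 < k) {a : ℝ}
    (ha : (∫ ω, g k ω ∂P) < k * a) : ∀ᵐ ω ∂P, ∀ᶠ n : ℕ in atTop, g n ω ≤ a * n := by
  obtain ⟨b, hb, hba⟩ := exists_between ha
  have hb0 : 0 ≤ b := (integral_nonneg (hg.nonneg k)).trans hb.le
  have hmp : MeasurePreserving θ P P := by simpa using (hθ 1 one_pos).toMeasurePreserving
  -- Along multiples of `k` the cocycle is dominated by a Birkhoff sum over `θ^[k]`; this is why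
  -- ergodicity of every power is required.
  have hB := eventually_birkhoffSum_le (hθ k hk) (hm k) (hi k) (hg.nonneg k) hb
  have hall : ∀ᵐ ω ∂P, ∀ r, ∀ᶠ q : ℕ in atTop, birkhoffSum θ^[k] (g k) q (θ^[r] ω) ≤ b * q :=
    ae_all_iff.2 fun r => (hmp.iterate r).quasiMeasurePreserving.ae hB
  filter_upwards [hall] with ω hω
  -- In the residue class of `r` modulo `k`, the initial cost `g r ω` is fixed and is absorbed by
  -- the gap `k * a - b`.
  refine .atTop_of_arithmetic hk.ne' fun r _ => ?_
  obtain ⟨Q, hQ⟩ := exists_nat_gt (g r ω / (k * a - b))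
  rw [div_lt_iff₀ (sub_pos.2 hba)] at hQ
  filter_upwards [hω r, eventually_ge_atTop Q] with q hq hqQ
  have hqQ' : (Q : ℝ) ≤ q := by exact_mod_cast hqQ
  have h := (hg.add_le r (k * q) ω).trans (add_le_add_right (hg.le_birkhoffSum k q _) _)
  rw [add_comm r] at h
  have hk' : (0 : ℝ) < k := by exact_mod_cast hk
  have ha0 : 0 ≤ a := by
    by_contra! hneg
    nlinarith
  have : 0 ≤ a * r := by positivity
  push_cast
  nlinarith

theorem tendsto_ae (hg : IsSubadditiveCocycle θ g) (hθ : ∀ k, 0 < k → Ergodic θ^[k] P)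
    (hm : ∀ n, Measurable (g n)) (hi : Integrable (g 1) P) :
    ∃ L : ℝ, 0 ≤ L ∧ (∀ᵐ ω ∂P, Tendsto (fun n : ℕ => g n ω / n) atTop (𝓝 L)) ∧
      Tendsto (fun n : ℕ => (∫ ω, g n ω ∂P) / n) atTop (𝓝 L) := by
  have hθ1 : Ergodic θ P := by simpa using hθ 1 one_pos
  have hi := hg.integrable hθ1.toMeasurePreserving hm hi
  have hs := hg.subadditive_integral hθ1.toMeasurePreserving hm hi
  have hnn : ∀ n : ℕ, 0 ≤ (∫ ω, g n ω ∂P) / n := fun n =>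
    div_nonneg (integral_nonneg (hg.nonneg n)) n.cast_nonneg
  have hbdd : BddBelow (Set.range fun n : ℕ => (∫ ω, g n ω ∂P) / n) :=
    ⟨0, by rintro _ ⟨n, rfl⟩; exact hnn n⟩
  have hlim := hs.tendsto_lim hbdd
  refine ⟨hs.lim, ge_of_tendsto' hlim hnn, ?_, hlim⟩
  have hlow : ∀ᵐ ω ∂P, ∀ m : ℕ, ∀ᶠ n : ℕ in atTop, (hs.lim - 1 / (m + 1)) * n ≤ g n ω :=
    ae_all_iff.2 fun m => hg.eventually_le hθ1 hm hi (L := hs.lim) (fun n => by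
      rcases Nat.eq_zero_or_pos n with rfl | hn
      · simpa using integral_nonneg (hg.nonneg 0)
      · have := hs.lim_le_div hbdd hn.ne'
        rw [le_div_iff₀ (by exact_mod_cast hn)] at this
        linarith) (sub_lt_self _ Nat.one_div_pos_of_nat)
  have hupp : ∀ᵐ ω ∂P, ∀ m : ℕ, ∀ᶠ n : ℕ in atTop, g n ω ≤ (hs.lim + 1 / (m + 1)) * n :=
    ae_all_iff.2 fun m => by
      obtain ⟨k, hk, hk0⟩ := ((hlim.eventually (gt_mem_nhds
        (lt_add_of_pos_right hs.lim (Nat.one_div_pos_of_nat (n := m))))).and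
          (eventually_gt_atTop 0)).exists
      refine hg.eventually_ge hθ hm hi hk0 ?_
      rwa [div_lt_iff₀ (by exact_mod_cast hk0), mul_comm] at hk
  filter_upwards [hlow, hupp] with ω hl hu
  refine tendsto_order.2 ⟨fun c hc => ?_, fun c hc => ?_⟩
  · obtain ⟨m, hm⟩ := exists_nat_one_div_lt (sub_pos.2 hc)
    filter_upwards [hl m, eventually_gt_atTop 0] with n hn hn0
    have : (0 : ℝ) < n := by exact_mod_cast hn0
    rw [lt_div_iff₀ this]
    nlinarith
  · obtain ⟨m, hm⟩ := exists_nat_one_div_lt (sub_pos.2 hc)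
    filter_upwards [hu m, eventually_gt_atTop 0] with n hn hn0
    have : (0 : ℝ) < n := by exact_mod_cast hn0
    rw [div_lt_iff₀ this]
    nlinarith

end IsSubadditiveCocycle

/-- Scheffé's lemma for non-negative functions and a constant limit. -/
theorem tendsto_eLpNorm_sub_const [IsProbabilityMeasure P] {f : ℕ → Ω → ℝ} {L : ℝ}
    (hi : ∀ n, Integrable (f n) P) (hf : ∀ n ω, 0 ≤ f n ω)
    (hae : ∀ᵐ ω ∂P, Tendsto (fun n => f n ω) atTop (𝓝 L))
    (hint : Tendsto (fun n => ∫ ω, f n ω ∂P) atTop (𝓝 L)) :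
    Tendsto (fun n => eLpNorm (fun ω => f n ω - L) 1 P) atTop (𝓝 0) := by
  have hpos : ∀ n, Integrable (fun ω => max (L - f n ω) 0) P := fun n =>
    ((integrable_const L).sub (hi n)).pos_part
  have h1 : Tendsto (fun n => ∫ ω, max (L - f n ω) 0 ∂P) atTop (𝓝 0) := by
    have := tendsto_integral_of_dominated_convergence (μ := P) (fun _ => |L|)
      (F := fun n ω => max (L - f n ω) 0) (f := fun _ => 0)
      (fun n => (hpos n).aestronglyMeasurable) (integrable_const _)
      (fun n => .of_forall fun ω => by
        rw [Real.norm_of_nonneg (le_max_right _ _)]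
        exact max_le (by linarith [le_abs_self L, hf n ω]) (abs_nonneg L))
      (by
        filter_upwards [hae] with ω hω
        simpa using (hω.const_sub L).max (tendsto_const_nhds (x := (0 : ℝ))))
    simpa using this
  -- An absolute value is the number plus twice its negative part. Non-negativity of `f n` bounds
  -- that negative part by `|L|`, so dominated convergence applies to it alone.
  have h2 : ∀ n, ∫ ω, |f n ω - L| ∂P = (∫ ω, f n ω ∂P - L) + 2 * ∫ ω, max (L - f n ω) 0 ∂P := by
    intro n
    have e : ∀ ω, |f n ω - L| = (f n ω - L) + 2 * max (L - f n ω) 0 := fun ω => by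
      rcases le_total (f n ω) L with h | h
      · rw [abs_of_nonpos (by linarith), max_eq_left (by linarith)]; ring
      · rw [abs_of_nonneg (by linarith), max_eq_right (by linarith)]; ring
    simp only [e]
    rw [integral_add (f := fun ω => f n ω - L) ((hi n).sub (integrable_const L))
      ((hpos n).const_mul 2), integral_sub (hi n) (integrable_const L), integral_const_mul]
    simp
  have h3 : Tendsto (fun n => ∫ ω, |f n ω - L| ∂P) atTop (𝓝 0) := by
    simp only [h2]
    simpa using (hint.sub_const L).add (h1.const_mul 2)
  have h4 := ENNReal.tendsto_ofReal h3
  rw [ENNReal.ofReal_zero] at h4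
  refine h4.congr fun n => ?_
  rw [eLpNorm_one_eq_lintegral_enorm,
    ofReal_integral_eq_lintegral_ofReal (f := fun ω => |f n ω - L|) ((hi n).sub (integrable_const L)).abs
      (.of_forall fun _ => abs_nonneg _)]
  simp [Real.enorm_eq_ofReal_abs]

end Ergodic

/-! ### Ergodicity of reindexings of an i.i.d. family -/

section Bernoulli

variable {I : Type*} (ν : Measure ℝ) [IsProbabilityMeasure ν]

theorem measurePreserving_comp_infinitePi {σ : I → I} (hσ : Function.Injective σ) :
    MeasurePreserving (fun w : I → ℝ => w ∘ σ) (Measure.infinitePi fun _ => ν)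
      (Measure.infinitePi fun _ => ν) :=
  ⟨by fun_prop, Measure.map_infinitePi_infinitePi_of_inj (P := fun _ : I => ν) hσ⟩

/-- Cylinder events over disjoint sets of coordinates are independent. -/
theorem measure_cylinder_inter_preimage {σ : I → I} [DecidableEq I] {F : Finset I}
    (hF : Disjoint F (F.image σ)) {S : Set (F → ℝ)} (hS : MeasurableSet S) :
    Measure.infinitePi (fun _ : I => ν)
        (cylinder F S ∩ (fun w : I → ℝ => w ∘ σ) ⁻¹' cylinder F S) =
      Measure.infinitePi (fun _ : I => ν) (cylinder F S) *
        Measure.infinitePi (fun _ : I => ν) ((fun w : I → ℝ => w ∘ σ) ⁻¹' cylinder F S) := by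
  have h := (iIndepFun_infinitePi (P := fun _ : I => ν) (X := fun _ x => x)
    (fun _ => measurable_id)).indepFun_finset F (F.image σ) hF fun i => measurable_pi_apply i
  let φ : (F.image σ → ℝ) → F → ℝ := fun u i => u ⟨σ i, Finset.mem_image_of_mem σ i.2⟩
  have hφ : Measurable φ := by fun_prop
  exact h.measure_inter_preimage_eq_mul S (φ ⁻¹' S) hS (hφ hS)

/-- A reindexing of an i.i.d. family which moves finite sets off themselves is ergodic. -/
theorem ergodic_comp_infinitePi [DecidableEq I] {σ : I → I} (hσ : Function.Injective σ)
    (hmove : ∀ F : Finset I, ∃ n, Disjoint F (F.image σ^[n])) :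
    Ergodic (fun w : I → ℝ => w ∘ σ) (Measure.infinitePi fun _ => ν) := by
  set Q := Measure.infinitePi fun _ : I => ν
  have hmp := measurePreserving_comp_infinitePi ν hσ
  refine ⟨hmp, ⟨fun A hA hinv => ?_⟩⟩
  have hiter : ∀ n, (fun w : I → ℝ => w ∘ σ)^[n] = fun w => w ∘ σ^[n] := fun n => by
    induction n with
    | zero => rfl
    | succ n ih => rw [Function.iterate_succ', ih, Function.iterate_succ]; rfl
  have hdense : Q.MeasureDense (measurableCylinders fun _ : I => ℝ) :=
    .of_generateFrom_isSetAlgebra_finite Q isSetAlgebra_measurableCylinders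
      generateFrom_measurableCylinders.symm
  -- Approximate `A` by a cylinder `C` and move `C` to an independent copy `D`; by invariance `D`
  -- approximates `A` equally well. Replacing `A` by `C ∩ D` costs `2ε`, and passing from the square
  -- of the measure of `C` to that of `A` another `2ε`.
  have key : ∀ ε > 0, |Q.real A - Q.real A ^ 2| ≤ 4 * ε := by
    intro ε hε
    obtain ⟨C, hC, hAC⟩ := hdense.approx A hA (measure_ne_top _ _) ε hε
    obtain ⟨F, S, hS, hCFS⟩ := (mem_measurableCylinders _).1 hC
    have hCm : MeasurableSet C := .of_mem_measurableCylinders hC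
    obtain ⟨n, hn⟩ := hmove F
    have hmpn := measurePreserving_comp_infinitePi ν (hσ.iterate n)
    have hinvn : (fun w : I → ℝ => w ∘ σ^[n]) ⁻¹' A = A := by
      rw [← hiter]
      exact Function.IsFixedPt.preimage_iterate hinv n
    set D := (fun w : I → ℝ => w ∘ σ^[n]) ⁻¹' C with hD
    have hDm : MeasurableSet D := hmpn.measurable hCm
    have h1 : Q.real (symmDiff A C) ≤ ε := ENNReal.toReal_le_of_le_ofReal hε.le hAC.le
    have h2 : Q.real (symmDiff A D) ≤ ε := by
      have : symmDiff A D = (fun w : I → ℝ => w ∘ σ^[n]) ⁻¹' symmDiff A C := by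
        rw [Set.preimage_symmDiff, hinvn]
      rwa [this, measureReal_def, hmpn.measure_preimage (hA.symmDiff hCm).nullMeasurableSet]
    have h3 : Q.real (C ∩ D) = Q.real C ^ 2 := by
      have hDC : Q D = Q C := hmpn.measure_preimage hCm.nullMeasurableSet
      have hind : Q (C ∩ D) = Q C * Q D := by
        rw [hD, hCFS]
        exact measure_cylinder_inter_preimage ν hn hS
      rw [measureReal_def, hind, hDC, ENNReal.toReal_mul, sq, measureReal_def]
    have h4 : |Q.real A - Q.real (C ∩ D)| ≤ 2 * ε := by
      refine (abs_measureReal_sub_le_measureReal_symmDiff hA.nullMeasurableSet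
        (hCm.inter hDm).nullMeasurableSet).trans ?_
      have hsub : symmDiff A (C ∩ D) ⊆ symmDiff A C ∪ symmDiff A D := by
        intro w
        simp only [Set.mem_symmDiff, Set.mem_union, Set.mem_inter_iff]
        tauto
      linarith [measureReal_mono (μ := Q) hsub, measureReal_union_le (μ := Q)
        (symmDiff A C) (symmDiff A D)]
    have h5 : |Q.real A - Q.real C| ≤ ε :=
      (abs_measureReal_sub_le_measureReal_symmDiff hA.nullMeasurableSet
        hCm.nullMeasurableSet).trans h1
    have hA1 : Q.real A ≤ 1 := measureReal_le_one
    have hC1 : Q.real C ≤ 1 := measureReal_le_one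
    have hA0 : 0 ≤ Q.real A := measureReal_nonneg
    have hC0 : 0 ≤ Q.real C := measureReal_nonneg
    rw [h3] at h4
    rw [abs_le] at h4 h5 ⊢
    constructor <;> nlinarith
  have hzero : Q.real A - Q.real A ^ 2 = 0 := by
    refine abs_eq_zero.1 (le_antisymm (le_of_forall_pos_le_add fun ε hε => ?_) (abs_nonneg _))
    linarith [key (ε / 4) (by positivity)]
  have : Q.real A * (1 - Q.real A) = 0 := by linarith
  rw [eventuallyConst_set']
  rcases mul_eq_zero.1 this with h | h
  · left
    rwa [measureReal_eq_zero_iff, ← ae_eq_empty] at h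
  · right
    rw [ae_eq_univ, ← measureReal_eq_zero_iff, measureReal_compl hA, probReal_univ, h]

end Bernoulli

/-! ### Passage times and lattice translations -/

section Lattice

variable {d : ℕ}

theorem pathTime_nonneg {w : Edge d → ℝ} (hw : ∀ e, 0 ≤ w e) {x y : Fin d → ℤ}
    (p : (latticeGraph d).Walk x y) : 0 ≤ pathTime w p :=
  List.sum_nonneg fun _ h => by
    obtain ⟨a, -, rfl⟩ := List.mem_map.1 h
    exact hw _

theorem passageTime_nonneg {w : Edge d → ℝ} (hw : ∀ e, 0 ≤ w e) (x y : Fin d → ℤ) :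
    0 ≤ passageTime w x y :=
  Real.iInf_nonneg fun p => pathTime_nonneg hw p

theorem passageTime_le_pathTime {w : Edge d → ℝ} (hw : ∀ e, 0 ≤ w e) {x y : Fin d → ℤ}
    (p : (latticeGraph d).Walk x y) : passageTime w x y ≤ pathTime w p :=
  ciInf_le ⟨0, by rintro _ ⟨q, rfl⟩; exact pathTime_nonneg hw q⟩ p

theorem passageTime_self {w : Edge d → ℝ} (hw : ∀ e, 0 ≤ w e) (x : Fin d → ℤ) :
    passageTime w x x = 0 :=
  le_antisymm (passageTime_le_pathTime hw .nil) (passageTime_nonneg hw x x)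

theorem pathTime_append (w : Edge d → ℝ) {x y z : Fin d → ℤ} (p : (latticeGraph d).Walk x y)
    (q : (latticeGraph d).Walk y z) : pathTime w (p.append q) = pathTime w p + pathTime w q := by
  simp [pathTime, SimpleGraph.Walk.darts_append]

theorem passageTime_triangle {w : Edge d → ℝ} (hw : ∀ e, 0 ≤ w e) {x y z : Fin d → ℤ}
    (hxy : Nonempty ((latticeGraph d).Walk x y)) (hyz : Nonempty ((latticeGraph d).Walk y z)) :
    passageTime w x z ≤ passageTime w x y + passageTime w y z :=
  le_ciInf_add_ciInf fun p q =>
    (passageTime_le_pathTime hw (p.append q)).trans (pathTime_append w p q).le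

/-- Countability of the set of paths is what makes the infimum of passage times measurable. -/
instance (x y : Fin d → ℤ) : Countable ((latticeGraph d).Walk x y) :=
  Function.Injective.countable (f := fun p => p.support) fun _ _ => SimpleGraph.Walk.ext_support

theorem measurable_pathTime {x y : Fin d → ℤ} (p : (latticeGraph d).Walk x y) :
    Measurable fun w : Edge d → ℝ => pathTime w p := by
  induction p with
  | nil => exact measurable_const
  | cons h p ih =>
    simp only [pathTime, SimpleGraph.Walk.darts_cons, List.map_cons, List.sum_cons] at ih ⊢
    exact (measurable_pi_apply _).add ih

theorem measurable_passageTime (x y : Fin d → ℤ) :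
    Measurable fun w : Edge d → ℝ => passageTime w x y :=
  .iInf fun p => measurable_pathTime p

/-- Translation by `v`, as an automorphism of the lattice. -/
def shiftIso (v : Fin d → ℤ) : latticeGraph d ≃g latticeGraph d where
  toEquiv := Equiv.addRight v
  map_rel_iff' := by simp [latticeGraph]

/-- The action of the translation by `v` on the edges of the lattice. -/
def edgeShift (v : Fin d → ℤ) : Edge d → Edge d := (shiftIso v).mapEdgeSet

theorem edgeShift_injective (v : Fin d → ℤ) : Function.Injective (edgeShift v) :=
  (shiftIso v).mapEdgeSet.injective

theorem pathTime_comp_edgeShift (v : Fin d → ℤ) (w : Edge d → ℝ) {x y : Fin d → ℤ}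
    (p : (latticeGraph d).Walk x y) :
    pathTime (w ∘ edgeShift v) p = pathTime w (p.map (shiftIso v).toHom) := by
  simp only [pathTime, SimpleGraph.Walk.darts_map, List.map_map]
  rfl

theorem surjective_walk_map {V V' : Type*} {G : SimpleGraph V} {G' : SimpleGraph V'}
    (φ : G ≃g G') (x y : V) :
    Function.Surjective fun p : G.Walk x y => p.map φ.toHom := by
  intro q
  refine ⟨(q.map φ.symm.toHom).copy (φ.symm_apply_apply x) (φ.symm_apply_apply y),
    SimpleGraph.Walk.ext_support ?_⟩
  rw [SimpleGraph.Walk.support_map, SimpleGraph.Walk.support_copy, SimpleGraph.Walk.support_map,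
    List.map_map]
  conv_rhs => rw [← List.map_id q.support]
  exact List.map_congr_left fun z _ => φ.apply_symm_apply z

theorem passageTime_comp_edgeShift (v : Fin d → ℤ) (w : Edge d → ℝ) (x y : Fin d → ℤ) :
    passageTime (w ∘ edgeShift v) x y = passageTime w (x + v) (y + v) := by
  have h : passageTime (w ∘ edgeShift v) x y =
      passageTime w ((shiftIso v).toHom x) ((shiftIso v).toHom y) := by
    rw [passageTime, passageTime, ← (surjective_walk_map (shiftIso v) x y).iInf_comp]
    exact iInf_congr fun p => pathTime_comp_edgeShift v w p
  exact h

theorem passageTime_comp_edgeShift_iterate (v : Fin d → ℤ) (n : ℕ) (w : Edge d → ℝ)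
    (x y : Fin d → ℤ) :
    passageTime (w ∘ (edgeShift v)^[n]) x y = passageTime w (x + n • v) (y + n • v) := by
  induction n generalizing w x y with
  | zero => simp
  | succ n ih =>
    rw [Function.iterate_succ', ← Function.comp_assoc, ih, passageTime_comp_edgeShift,
      succ_nsmul, add_assoc, add_assoc]

/-- Twice the `i`-th coordinate of the midpoint of an edge. -/
def edgeHeight (i : Fin d) (e : Edge d) : ℤ :=
  Sym2.lift ⟨fun x y => x i + y i, fun x y => add_comm (x i) (y i)⟩ e.1

theorem edgeHeight_edgeShift (i : Fin d) (v : Fin d → ℤ) (e : Edge d) :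
    edgeHeight i (edgeShift v e) = edgeHeight i e + 2 * v i := by
  obtain ⟨e, he⟩ := e
  induction e using Sym2.ind with
  | _ x y =>
    change (x + v) i + (y + v) i = x i + y i + 2 * v i
    simp only [Pi.add_apply]
    ring

theorem edgeHeight_edgeShift_iterate (i : Fin d) (v : Fin d → ℤ) (n : ℕ) (e : Edge d) :
    edgeHeight i ((edgeShift v)^[n] e) = edgeHeight i e + n * (2 * v i) := by
  induction n with
  | zero => simp
  | succ n ih =>
    rw [Function.iterate_succ_apply', edgeHeight_edgeShift, ih]
    push_cast
    ring

/-- Along a coordinate where `v` is nonzero, the heights of the translates form an arithmetic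
progression with nonzero difference. -/
theorem edgeShift_iterate_left_injective {v : Fin d → ℤ} (hv : v ≠ 0) (e : Edge d) :
    Function.Injective fun n => (edgeShift v)^[n] e := by
  obtain ⟨i, hi⟩ := Function.ne_iff.1 hv
  intro m n h
  have h := congrArg (edgeHeight i) h
  simp only [edgeHeight_edgeShift_iterate, add_right_inj] at h
  exact_mod_cast mul_right_cancel₀ (mul_ne_zero two_ne_zero hi) h

/-- If no orbit of `σ` returns, then a suitable iterate of `σ` moves a given finite set off
itself. -/
theorem exists_disjoint_image_iterate {I : Type*} [DecidableEq I] {σ : I → I}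
    (h : ∀ e, Function.Injective fun n => σ^[n] e) (F : Finset I) :
    ∃ n, Disjoint F (F.image σ^[n]) := by
  -- For each pair `e`, `f` in `F` at most one `n` carries `e` to `f`, so only finitely many `n` are
  -- excluded.
  have hfin : (⋃ e ∈ F, ⋃ f ∈ F, {n | σ^[n] e = f}).Finite :=
    F.finite_toSet.biUnion fun e _ => F.finite_toSet.biUnion fun f _ =>
      Set.Subsingleton.finite fun m hm n hn => h e (hm.trans hn.symm)
  obtain ⟨n, hn⟩ := hfin.exists_notMem
  refine ⟨n, Finset.disjoint_right.2 fun f hf hfF => hn ?_⟩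
  obtain ⟨e, he, rfl⟩ := Finset.mem_image.1 hf
  simp only [Set.mem_iUnion]
  exact ⟨e, he, _, hfF, rfl⟩

theorem ergodic_edgeShift (ν : Measure ℝ) [IsProbabilityMeasure ν] {v : Fin d → ℤ} (hv : v ≠ 0)
    {k : ℕ} (hk : 0 < k) :
    Ergodic (fun w : Edge d → ℝ => w ∘ edgeShift v)^[k] (Measure.infinitePi fun _ => ν) := by
  classical
  have hiter : (fun w : Edge d → ℝ => w ∘ edgeShift v)^[k] = fun w => w ∘ (edgeShift v)^[k] := by
    clear hk
    induction k with
    | zero => rfl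
    | succ k ih => rw [Function.iterate_succ', ih, Function.iterate_succ]; rfl
  rw [hiter]
  refine ergodic_comp_infinitePi ν ((edgeShift_injective v).iterate k) fun F =>
    exists_disjoint_image_iterate (fun e m n h => ?_) F
  simp only [← Function.iterate_mul] at h
  exact Nat.eq_of_mul_eq_mul_left hk (edgeShift_iterate_left_injective hv e h)

theorem adj_of_coordinate {x y : Fin d → ℤ} (k : Fin d) (hk : |x k - y k| = 1)
    (h : ∀ l, l ≠ k → x l = y l) : (latticeGraph d).Adj x y := by
  change ∑ i, |x i - y i| = 1
  rw [Finset.sum_eq_single k (fun l _ hl => by simp [h l hl]) (by simp), hk]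

theorem nonempty_walk_add_nsmul_e₁ (hd : 0 < d) (x : Fin d → ℤ) (n : ℕ) :
    Nonempty ((latticeGraph d).Walk x (x + n • e₁ d)) := by
  induction n with
  | zero => exact ⟨SimpleGraph.Walk.nil.copy rfl (by simp)⟩
  | succ n ih =>
    obtain ⟨p⟩ := ih
    refine ⟨p.concat (adj_of_coordinate ⟨0, hd⟩ ?_ fun l hl => ?_)⟩
    · simp [e₁, add_mul]
    · have : (l : ℕ) ≠ 0 := fun h => hl (Fin.ext h)
      simp [e₁, this]

theorem e₁_ne_zero (hd : 0 < d) : e₁ d ≠ 0 := fun h => by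
  simpa [e₁] using congrFun h ⟨0, hd⟩

/-- The passage times along the first axis, for the positive parts of the weights. -/
noncomputable def axisTime (d : ℕ) (n : ℕ) (w : Edge d → ℝ) : ℝ :=
  passageTime (fun e => max (w e) 0) 0 (n • e₁ d)

theorem measurable_axisTime (n : ℕ) : Measurable (axisTime d n) :=
  (measurable_passageTime 0 (n • e₁ d)).comp (by fun_prop)

theorem isSubadditiveCocycle_axisTime (hd : 0 < d) :
    IsSubadditiveCocycle (fun w : Edge d → ℝ => w ∘ edgeShift (e₁ d)) (axisTime d) where
  nonneg n w := passageTime_nonneg (fun _ => le_max_right _ _) _ _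
  zero w := by
    rw [axisTime, zero_nsmul]
    exact passageTime_self (fun _ => le_max_right _ _) _
  add_le m n w := by
    have hiter : (fun w : Edge d → ℝ => w ∘ edgeShift (e₁ d))^[m] w =
        w ∘ (edgeShift (e₁ d))^[m] := by
      induction m generalizing w with
      | zero => rfl
      | succ m ih => rw [Function.iterate_succ_apply, ih, Function.iterate_succ']; rfl
    have h := passageTime_comp_edgeShift_iterate (e₁ d) m (fun e => max (w e) 0) 0 (n • e₁ d)
    rw [zero_add, ← add_nsmul, add_comm n] at h
    rw [hiter]
    change _ ≤ _ + passageTime ((fun e => max (w e) 0) ∘ (edgeShift (e₁ d))^[m]) 0 (n • e₁ d)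
    rw [h]
    refine passageTime_triangle (fun _ => le_max_right _ _) ?_ ?_
    · simpa using nonempty_walk_add_nsmul_e₁ hd 0 m
    · simpa only [add_nsmul] using nonempty_walk_add_nsmul_e₁ hd (m • e₁ d) n

end Lattice

/-! ### Edge-disjoint paths from the origin to its neighbour -/

section DisjointPaths

variable {m : ℕ}

/-- The point with coordinate `a` along the first axis and `b` along the `j`-th axis. -/
def planePoint (j : Fin (m + 2)) (a b : ℤ) : Fin (m + 2) → ℤ :=
  fun k => if k = 0 then a else if k = j then b else 0

theorem planePoint_zero (j : Fin (m + 2)) : planePoint j 0 0 = 0 := by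
  ext k; simp [planePoint]

theorem planePoint_one (j : Fin (m + 2)) : planePoint j 1 0 = e₁ (m + 2) := by
  ext k
  by_cases hk : k = 0
  · simp [planePoint, e₁, hk]
  · have : (k : ℕ) ≠ 0 := fun h => hk (Fin.ext h)
    simp [planePoint, e₁, hk, this]

theorem adj_planePoint_left (j : Fin (m + 2)) {a a' : ℤ} (h : |a - a'| = 1) (b : ℤ) :
    (latticeGraph (m + 2)).Adj (planePoint j a b) (planePoint j a' b) :=
  adj_of_coordinate 0 (by simpa [planePoint] using h) fun l hl => by simp [planePoint, hl]

theorem adj_planePoint_right {j : Fin (m + 2)} (hj : j ≠ 0) (a : ℤ) {b b' : ℤ}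
    (h : |b - b'| = 1) :
    (latticeGraph (m + 2)).Adj (planePoint j a b) (planePoint j a b') :=
  adj_of_coordinate j (by simpa [planePoint, hj] using h) fun l hl => by simp [planePoint, hl]

/-- The region containing the inner vertices of the detour from `0` to `e₁` that starts in the
direction `i`. -/
def detourRegion (i : Fin (m + 2) × Bool) (x : Fin (m + 2) → ℤ) : Prop :=
  if i.1 = 0 then i.2 = false ∧ (x 0 = -1 ∨ x 0 = 2 ∨ x 1 = 2)
  else (x 0 = 0 ∨ x 0 = 1) ∧ (∀ k, k ≠ 0 → k ≠ i.1 → x k = 0) ∧ x i.1 = if i.2 then 1 else -1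

/-- The region of `(0, true)`, the direct edge, is empty. The long detour `(0, false)` stays in `x 0
∈ {-1, 2}` or `x 1 = 2`, which the side detours avoid; those are told apart by their only nonzero
coordinate off the first axis and its sign. -/
theorem detourRegion_unique {i i' : Fin (m + 2) × Bool} {x : Fin (m + 2) → ℤ}
    (h : detourRegion i x) (h' : detourRegion i' x) : i = i' := by
  have aux : ∀ {i i' : Fin (m + 2) × Bool}, i.1 = 0 → i'.1 ≠ 0 → detourRegion i x →
      detourRegion i' x → False := by
    rintro ⟨j, s⟩ ⟨j', s'⟩ hj hj' h h'
    simp only [detourRegion] at hj hj' h h'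
    rw [if_pos hj] at h
    rw [if_neg hj'] at h'
    obtain ⟨h0, hk, hs⟩ := h'
    have h2 : x 1 = 2 := by omega
    by_cases h1 : (1 : Fin (m + 2)) = j'
    · rw [← h1] at hs
      split_ifs at hs <;> omega
    · have := hk 1 one_ne_zero h1
      omega
  by_cases hi : i.1 = 0 <;> by_cases hi' : i'.1 = 0
  · rw [detourRegion, if_pos hi] at h
    rw [detourRegion, if_pos hi'] at h'
    exact Prod.ext (hi.trans hi'.symm) (h.1.trans h'.1.symm)
  · exact (aux hi hi' h h').elim
  · exact (aux hi' hi h' h).elim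
  · obtain ⟨j, s⟩ := i
    obtain ⟨j', s'⟩ := i'
    simp only [detourRegion] at hi hi' h h'
    rw [if_neg hi] at h
    rw [if_neg hi'] at h'
    have hj : j = j' := by
      by_contra hne
      have h0 := h'.2.1 j hi hne
      have h1 := h.2.2
      rw [h0] at h1
      split_ifs at h1
      all_goals omega
    subst hj
    have h1 := h.2.2.symm.trans h'.2.2
    cases s <;> cases s' <;> simp_all

/-- The edges allowed in the detour from `0` to `e₁` that starts in the direction `i`. -/
def DetourEdge (i : Fin (m + 2) × Bool) (x y : Fin (m + 2) → ℤ) : Prop :=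
  (detourRegion i x ∧ (detourRegion i y ∨ y = 0 ∨ y = e₁ _)) ∨
    (detourRegion i y ∧ (x = 0 ∨ x = e₁ _)) ∨
    (i = (0, true) ∧ (x = 0 ∨ x = e₁ _) ∧ (y = 0 ∨ y = e₁ _))

theorem not_detourRegion_zero (i : Fin (m + 2) × Bool) : ¬ detourRegion i 0 := by
  unfold detourRegion
  split_ifs <;> simp

theorem not_detourRegion_e₁ (i : Fin (m + 2) × Bool) : ¬ detourRegion i (e₁ _) := by
  unfold detourRegion
  split_ifs with h h'
  · simp [e₁]
  all_goals
    have : (i.1 : ℕ) ≠ 0 := fun h0 => h (Fin.ext h0)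
    simp [e₁, this]

theorem detourEdge_symm {i : Fin (m + 2) × Bool} {x y : Fin (m + 2) → ℤ} (h : DetourEdge i x y) :
    DetourEdge i y x := by
  unfold DetourEdge at *
  tauto

/-- Every allowed edge other than the direct one has an endpoint in its region, and regions contain
neither `0` nor `e₁`. Hence disjointness of the regions separates the edges. -/
theorem detourEdge_unique {i i' : Fin (m + 2) × Bool} {x y : Fin (m + 2) → ℤ}
    (h : DetourEdge i x y) (h' : DetourEdge i' x y) : i = i' := by
  have hends : ∀ {z : Fin (m + 2) → ℤ} {j}, (z = 0 ∨ z = e₁ _) → ¬ detourRegion j z := by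
    rintro z j (rfl | rfl)
    · exact not_detourRegion_zero j
    · exact not_detourRegion_e₁ j
  rcases h with ⟨hx, hy⟩ | ⟨hy, hx⟩ | ⟨hi, hx, hy⟩ <;>
    rcases h' with ⟨hx', hy'⟩ | ⟨hy', hx'⟩ | ⟨hi', hx', hy'⟩
  · exact detourRegion_unique hx hx'
  · exact (hends hx' hx).elim
  · exact (hends hx' hx).elim
  · exact (hends hx hx').elim
  · exact detourRegion_unique hy hy'
  · exact (hends hy' hy).elim
  · exact (hends hx hx').elim
  · exact (hends hy hy').elim
  · rw [hi, hi']

/-- The routes are the direct edge, the `2(d - 1)` three-step routes through a side neighbour, and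
one nine-step route that leaves through `-e₁`, crosses at height 2 above the side route at height 1,
and returns through `2e₁`. -/
theorem exists_detour (i : Fin (m + 2) × Bool) :
    ∃ p : (latticeGraph (m + 2)).Walk 0 (e₁ (m + 2)), p.length ≤ 9 ∧
      ∀ a ∈ p.darts, DetourEdge i a.fst a.snd := by
  obtain ⟨j, s⟩ := i
  by_cases hj : j = 0
  · subst hj
    have h1 : (1 : Fin (m + 2)) ≠ 0 := one_ne_zero
    rw [← planePoint_zero 1, ← planePoint_one 1]
    cases s
    · have A := fun {a a' : ℤ} => adj_planePoint_left (m := m) 1 (a := a) (a' := a')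
      have B := fun {b b' : ℤ} (a : ℤ) => adj_planePoint_right h1 a (b := b) (b' := b')
      refine ⟨.cons (A (a' := -1) (by simp) 0) <| .cons (B (b' := 1) (-1) (by simp)) <|
        .cons (B (b' := 2) (-1) (by simp)) <| .cons (A (a' := 0) (by simp) 2) <|
        .cons (A (a' := 1) (by simp) 2) <| .cons (A (a' := 2) (by simp) 2) <|
        .cons (B (b' := 1) 2 (by simp)) <| .cons (B (b' := 0) 2 (by simp)) <|
        .cons (A (a' := 1) (by simp) 0) .nil, by simp, ?_⟩
      simp [DetourEdge, detourRegion, planePoint_zero, planePoint_one]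
      simp [planePoint]
    · refine ⟨.cons (adj_planePoint_left 1 (by simp) 0) .nil, by simp, ?_⟩
      simp [DetourEdge, planePoint_zero, planePoint_one]
  · rw [← planePoint_zero j, ← planePoint_one j]
    let σ : ℤ := if s then 1 else -1
    have hσ : |σ| = 1 := by cases s <;> simp [σ]
    refine ⟨.cons (adj_planePoint_right hj 0 (b' := σ) (by simpa using hσ)) <|
      .cons (adj_planePoint_left j (a' := 1) (by simp) σ) <|
      .cons (adj_planePoint_right hj 1 (b' := 0) (by simpa using hσ)) .nil, by simp, ?_⟩
    have hR : ∀ a, (a = 0 ∨ a = 1) → detourRegion (j, s) (planePoint j a σ) := fun a ha => by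
      rw [detourRegion, if_neg hj]
      refine ⟨by simpa [planePoint] using ha, fun k h0 hk => ?_, by simp [planePoint, hj, σ]⟩
      simp [planePoint, h0, show k ≠ j from hk]
    simp [DetourEdge, planePoint_zero, planePoint_one, hR]

end DisjointPaths

/-! ### Integrability of the one-step passage time -/

section Integrability

variable {d : ℕ}

theorem exists_edge_pathTime_le (w : Edge d → ℝ) {x y : Fin d → ℤ}
    (hxy : x ≠ y) (p : (latticeGraph d).Walk x y) :
    ∃ a ∈ p.darts, pathTime w p ≤ p.length * w ⟨a.edge, a.edge_mem⟩ := by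
  classical
  have hne : p.darts.toFinset.Nonempty := by
    rw [List.toFinset_nonempty_iff, ← List.length_pos_iff, SimpleGraph.Walk.length_darts,
      Nat.pos_iff_ne_zero]
    exact fun h => hxy (SimpleGraph.Walk.eq_of_length_eq_zero h)
  obtain ⟨a, ha, hmax⟩ := p.darts.toFinset.exists_max_image (fun a => w ⟨a.edge, a.edge_mem⟩) hne
  refine ⟨a, List.mem_toFinset.1 ha, ?_⟩
  have h := List.sum_le_card_nsmul (p.darts.map fun a => w ⟨a.edge, a.edge_mem⟩)
    (w ⟨a.edge, a.edge_mem⟩) fun r hr => by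
      obtain ⟨b, hb, rfl⟩ := List.mem_map.1 hr
      exact hmax b (List.mem_toFinset.2 hb)
  simpa [pathTime] using h

/-- On each detour the heaviest edge, times the length, bounds the passage time. That edge depends
on `w`, so only its membership in a fixed finite set is recorded. -/
theorem exists_disjoint_edge_sets (hd : 2 ≤ d) :
    ∃ F : Fin (2 * d) → Finset (Edge d), (∀ i j e, e ∈ F i → e ∈ F j → i = j) ∧
      ∀ w : Edge d → ℝ, (∀ e, 0 ≤ w e) → ∀ i, ∃ e ∈ F i, passageTime w 0 (e₁ d) ≤ 9 * w e := by
  classical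
  obtain ⟨m, rfl⟩ : ∃ m, d = m + 2 := ⟨d - 2, by omega⟩
  let φ : Fin (2 * (m + 2)) ≃ Fin (m + 2) × Bool :=
    (Fintype.equivFinOfCardEq (by simp [mul_comm])).symm
  choose p hlen hp using fun i => exists_detour (m := m) i
  refine ⟨fun i => ((p (φ i)).darts.map fun a => ⟨a.edge, a.edge_mem⟩).toFinset,
    fun i j e hi hj => ?_, fun w hw i => ?_⟩
  · simp only [List.mem_toFinset, List.mem_map] at hi hj
    obtain ⟨a, ha, rfl⟩ := hi
    obtain ⟨b, hb, hab⟩ := hj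
    have ha := hp _ a ha
    have hb := hp _ b hb
    rw [Subtype.mk.injEq, SimpleGraph.dart_edge_eq_iff] at hab
    rcases hab with rfl | rfl
    · exact φ.injective (detourEdge_unique ha hb)
    · exact φ.injective (detourEdge_unique ha (detourEdge_symm hb))
  · obtain ⟨a, ha, hle⟩ := exists_edge_pathTime_le w (e₁_ne_zero (by omega)).symm (p (φ i))
    refine ⟨_, List.mem_toFinset.2 (List.mem_map.2 ⟨a, ha, rfl⟩),
      (passageTime_le_pathTime hw _).trans (hle.trans ?_)⟩
    exact mul_le_mul_of_nonneg_right (by exact_mod_cast hlen (φ i)) (hw _)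

theorem integrable_axisTime_one (hd : 2 ≤ d) {ν : Measure ℝ} [IsProbabilityMeasure ν]
    (hmin : Integrable (fun u : Fin (2 * d) → ℝ => ⨅ i, max (u i) 0)
      (Measure.infinitePi fun _ => ν)) :
    Integrable (axisTime d 1) (Measure.infinitePi fun _ => ν) := by
  classical
  obtain ⟨F, hF, hle⟩ := exists_disjoint_edge_sets hd
  have : Nonempty (Fin (2 * d)) := ⟨⟨0, by omega⟩⟩
  have hc : ∀ c ∈ Fintype.piFinset F, Integrable (fun w : Edge d → ℝ => ⨅ i, max (w (c i)) 0)
      (Measure.infinitePi fun _ => ν) := fun c hc => by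
    rw [Fintype.mem_piFinset] at hc
    have hinj : Function.Injective c := fun i j h => hF i j (c i) (hc i) (h ▸ hc j)
    rw [← Measure.map_infinitePi_infinitePi_of_inj (P := fun _ : Edge d => ν) hinj] at hmin
    exact hmin.comp_measurable (by fun_prop)
  -- The heaviest edges vary with `w`, so the bound sums over all finitely many selections of one
  -- edge per detour. Disjointness makes each selection injective, and its minimum has the law of
  -- the minimum of `2d` independent copies.
  refine ((integrable_finsetSum _ hc).const_mul 9).mono'
    (measurable_axisTime 1).aestronglyMeasurable (.of_forall fun w => ?_)
  rw [Real.norm_of_nonneg ((isSubadditiveCocycle_axisTime (by omega)).nonneg 1 w)]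
  choose c hcF hc using hle (fun e => max (w e) 0) fun _ => le_max_right _ _
  have h1 : axisTime d 1 w / 9 ≤ ⨅ i, max (w (c i)) 0 := le_ciInf fun i => by
    rw [axisTime, one_nsmul]
    linarith [hc i]
  have h2 := Finset.single_le_sum (f := fun c : Fin (2 * d) → Edge d => ⨅ i, max (w (c i)) 0)
    (fun c _ => Real.iInf_nonneg fun i => le_max_right _ _) (Fintype.mem_piFinset.2 hcF)
  linarith

end Integrability

end FPP

/-! ### Transfer from the product space to the given family -/

theorem mainTheorem3 (d : ℕ) (hd : 2 ≤ d)
    {Ω : Type*} [MeasurableSpace Ω] (P : Measure Ω) [IsProbabilityMeasure P]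
    (ν : Measure ℝ)
    (τ : FPP.Edge d → Ω → ℝ)
    (hτ_meas : ∀ e, Measurable (τ e))
    (hτ_nonneg : ∀ e, ∀ᵐ ω ∂P, 0 ≤ τ e ω)
    (hτ_indep : iIndepFun τ P)
    (hτ_law : ∀ e, HasLaw (τ e) ν P)
    {Ω' : Type*} [MeasurableSpace Ω'] (P' : Measure Ω') [IsProbabilityMeasure P']
    (t : Fin (2 * d) → Ω' → ℝ)
    (ht_meas : ∀ i, Measurable (t i))
    (ht_indep : iIndepFun t P')
    (ht_law : ∀ i, HasLaw (t i) ν P')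
    (hmin : Integrable (fun ω => ⨅ i, t i ω) P') :
    ∃ μ : ℝ, 0 ≤ μ ∧
      (∀ᵐ ω ∂P, Tendsto
        (fun n : ℕ => FPP.passageTime (fun e => τ e ω) 0 (n • FPP.e₁ d) / (n : ℝ))
        atTop (𝓝 μ)) ∧
      (∀ n : ℕ, Integrable (fun ω => FPP.passageTime (fun e => τ e ω) 0 (n • FPP.e₁ d)) P) ∧
      Tendsto
        (fun n : ℕ => eLpNorm
          (fun ω => FPP.passageTime (fun e => τ e ω) 0 (n • FPP.e₁ d) / (n : ℝ) - μ) 1 P)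
        atTop (𝓝 0) := by
  classical
  have hd0 : 0 < d := by omega
  have : IsProbabilityMeasure ν := by
    rw [← (ht_law ⟨0, by omega⟩).map_eq]
    exact Measure.isProbabilityMeasure_map (ht_meas _).aemeasurable
  -- Only the existence of some edge is extracted here, so that `ν` is seen to be the law of a
  -- non-negative variable.
  obtain ⟨F, -, hF⟩ := FPP.exists_disjoint_edge_sets hd
  obtain ⟨e, -, -⟩ := hF (fun _ => 0) (fun _ => le_rfl) ⟨0, by omega⟩
  have hν : ∀ᵐ x ∂ν, (0 : ℝ) ≤ x := by
    rw [← (hτ_law e).map_eq]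
    exact (ae_map_iff (hτ_meas e).aemeasurable measurableSet_Ici).2 (hτ_nonneg e)
  have ht_nonneg : ∀ᵐ ω ∂P', ∀ i, 0 ≤ t i ω := ae_all_iff.2 fun i => by
    rw [← (ht_law i).map_eq] at hν
    exact ae_of_ae_map (ht_meas i).aemeasurable hν
  have hmin' : Integrable (fun u : Fin (2 * d) → ℝ => ⨅ i, max (u i) 0)
      (Measure.infinitePi fun _ => ν) := by
    have hlaw := ht_indep.hasLaw_infinitePi ht_law (by fun_prop)
    rw [← hlaw.map_eq, integrable_map_measure
      (Measurable.iInf fun i => by fun_prop).aestronglyMeasurable (by fun_prop)]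
    refine hmin.congr ?_
    filter_upwards [ht_nonneg] with ω hω
    exact iInf_congr fun i => (max_eq_left (hω i)).symm
  let Φ : Ω → FPP.Edge d → ℝ := fun ω e => τ e ω
  have hΦ : MeasurePreserving Φ P (Measure.infinitePi fun _ => ν) :=
    ⟨by fun_prop, (hτ_indep.hasLaw_infinitePi hτ_law (by fun_prop)).map_eq⟩
  have hg := FPP.isSubadditiveCocycle_axisTime hd0
  have hi1 := FPP.integrable_axisTime_one hd hmin'
  have herg := fun k (hk : 0 < k) => FPP.ergodic_edgeShift ν (FPP.e₁_ne_zero hd0) hk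
  obtain ⟨L, hL0, hae, hint⟩ := hg.tendsto_ae herg FPP.measurable_axisTime hi1
  have hi : ∀ n, Integrable (fun ω => FPP.axisTime d n (Φ ω)) P := fun n =>
    hΦ.integrable_comp_of_integrable
      (hg.integrable (FPP.measurePreserving_comp_infinitePi ν (FPP.edgeShift_injective _))
        FPP.measurable_axisTime hi1 n)
  have hae' : ∀ᵐ ω ∂P, Tendsto (fun n : ℕ => FPP.axisTime d n (Φ ω) / n) atTop (𝓝 L) :=
    hΦ.quasiMeasurePreserving.ae hae
  -- There are countably many edges, so almost surely all weights are non-negative at once and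
  -- taking positive parts changes nothing.
  have heq : ∀ᵐ ω ∂P, ∀ n : ℕ,
      FPP.axisTime d n (Φ ω) = FPP.passageTime (fun e => τ e ω) 0 (n • FPP.e₁ d) := by
    filter_upwards [ae_all_iff.2 hτ_nonneg] with ω hω n
    simp only [FPP.axisTime, Φ, max_eq_left (hω _)]
  refine ⟨L, hL0, ?_, fun n => (hi n).congr (heq.mono fun ω h => h n), ?_⟩
  · filter_upwards [hae', heq] with ω hω h
    simpa only [h] using hω
  · refine (FPP.tendsto_eLpNorm_sub_const (fun n => (hi n).div_const n)
      (fun n ω => div_nonneg (hg.nonneg n _) n.cast_nonneg) hae' ?_).congr fun n =>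
        eLpNorm_congr_ae (heq.mono fun ω h => by simp only [h n])
    simpa only [integral_div, FPP.integral_comp_of_measurePreserving hΦ
      (FPP.measurable_axisTime _)] using hint
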